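/- Let $H$ be a separable complex Hilbert space and let $A$, with domain $D(A)\subset H$, be a (possibly unbounded) self-adjoint operator on $H$, i.e. $D(A)$ is dense and $A^{*}=A$, domains included. For a measure space $(Y,\mu)$ and a measurable function $f:Y\to\mathbb{R}$, let $M_f$ denote the operator of multiplication by $f$ on $L^2(Y,\mu)=L^2(Y,\mu;\mathbb{C})$: $$D(M_f)=\{\varphi\in L^2(Y,\mu)\;:\; f\varphi\in L^2(Y,\mu)\},\qquad M_f\varphi=f\varphi .$$ Then there exist a finite measure space $(Y,\mu)$, a unitary operator $U:H\to L^2(Y,\mu)$ and a measurable function $f:Y\to\mathbb{R}$ (in particular, $f$ is finite $\mu$-almost everywhere) such that for every $v\in H$ $$v\in D(A)\iff Uv\in D(M_f),$$ and $$UAU^{-1}=M_f\quad\text{on } U(D(A)).$$ -/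

import Mathlib

open MeasureTheory

/-- The (in general unbounded) operator `M_f` of multiplication by the real function `f` on
the complex Hilbert space `L²(Y, μ)`: its domain consists of all `φ ∈ L²(Y, μ)` such that
`f φ ∈ L²(Y, μ)`, and it maps such a `φ` to (the class of) `f φ`. -/
noncomputable def mulOperator {Y : Type*} [MeasurableSpace Y] (μ : Measure Y) (f : Y → ℝ) :
    Lp ℂ 2 μ →ₗ.[ℂ] Lp ℂ 2 μ where
  domain :=
    { carrier := {φ | MemLp (fun y => (f y : ℂ) * φ y) 2 μ}
      zero_mem' := by
        have h : (fun y => (f y : ℂ) * (0 : Lp ℂ 2 μ) y) =ᵐ[μ] 0 := by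
          filter_upwards [Lp.coeFn_zero ℂ 2 μ] with y hy
          simp only [hy, Pi.zero_apply, mul_zero]
        exact (memLp_congr_ae h).2 MemLp.zero
      add_mem' := by
        intro φ ψ hφ hψ
        refine (memLp_congr_ae ?_).1 (MemLp.add hφ hψ)
        filter_upwards [Lp.coeFn_add φ ψ] with y hy
        simp only [Pi.add_apply, hy, mul_add]
      smul_mem' := by
        intro c φ hφ
        refine (memLp_congr_ae ?_).1 (MemLp.const_smul hφ c)
        filter_upwards [Lp.coeFn_smul c φ] with y hy
        simp only [Pi.smul_apply, hy, smul_eq_mul, mul_left_comm] }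
  toFun :=
    { toFun := fun φ => MemLp.toLp (fun y => (f y : ℂ) * (φ : Lp ℂ 2 μ) y) φ.2
      map_add' := by
        intro φ ψ
        rw [← MemLp.toLp_add]
        refine MemLp.toLp_congr _ _ ?_
        filter_upwards [Lp.coeFn_add (φ : Lp ℂ 2 μ) (ψ : Lp ℂ 2 μ)] with y hy
        simp only [Submodule.coe_add, Pi.add_apply, hy, mul_add]
      map_smul' := by
        intro c φ
        rw [RingHom.id_apply, ← MemLp.toLp_const_smul]
        refine MemLp.toLp_congr _ _ ?_
        filter_upwards [Lp.coeFn_smul c (φ : Lp ℂ 2 μ)] with y hy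
        simp only [Submodule.coe_smul, Pi.smul_apply, hy, smul_eq_mul, mul_left_comm] }

/-! ### Cyclic decomposition of a representation of `C(Z, ℂ)` -/

section CyclicVectors

variable {H : Type*} [NormedAddCommGroup H] [InnerProductSpace ℂ H] [CompleteSpace H]
  {Z : Type*} [TopologicalSpace Z]

/-! The unbounded case reduces to the bounded normal operator `T = (A + i)⁻¹`
(`IsSelfAdjoint.exists_resolvent_I`), whose range is the domain of `A`. The continuous functional
calculus of `T` represents `C(Z, ℂ)`, with `Z` the spectrum of `T`. By Zorn and separability, `H` is
the closed sum of countably many orthogonal cyclic subspaces. Riesz–Markov turns each into an L²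
space over `Z`, since `‖π φ x‖² = ∫ |φ|²`; together they form L² of a finite measure on `ℕ × Z`,
where `T` multiplies by a function `g`.

Since `T` is injective, `g ≠ 0` almost everywhere, and `A = T⁻¹ - i` becomes multiplication by `1/g
- i`. This is real: `T* - T = 2i T*T` passes to the spectrum and says `Im (1/g) = 1`. Hence `f = Re
(1/g)`. -/

theorem StarAlgHom.inner_apply_left (π : C(Z, ℂ) →⋆ₐ[ℂ] (H →L[ℂ] H)) (φ : C(Z, ℂ)) (u v : H) :
    inner ℂ (π φ u) v = inner ℂ u (π (star φ) v) := by
  rw [map_star, ContinuousLinearMap.star_eq_adjoint, ContinuousLinearMap.adjoint_inner_right]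

theorem StarAlgHom.norm_apply_sq (π : C(Z, ℂ) →⋆ₐ[ℂ] (H →L[ℂ] H)) (φ : C(Z, ℂ)) (u : H) :
    ‖π φ u‖ ^ 2 = (inner ℂ u (π (star φ * φ) u)).re := by
  rw [map_mul, mul_apply_eq_comp, ← StarAlgHom.inner_apply_left]
  exact (inner_self_eq_norm_sq (𝕜 := ℂ) _).symm

/-- The spectral measure of a vector `x` under a representation of `C(Z, ℂ)`. -/
theorem exists_spectralMeasure [CompactSpace Z] [T2Space Z] [MeasurableSpace Z] [BorelSpace Z]
    (π : C(Z, ℂ) →⋆ₐ[ℂ] (H →L[ℂ] H)) (x : H) :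
    ∃ μ : Measure Z, IsFiniteMeasure μ ∧
      ∀ φ : C(Z, ℂ), ∫ z, ‖φ z‖ ^ 2 ∂μ = ‖π φ x‖ ^ 2 := by
  let ι : CompactlySupportedContinuousMap Z ℝ → C(Z, ℂ) := fun g =>
    ⟨fun z => (g z : ℂ), by fun_prop⟩
  let Λ₀ : CompactlySupportedContinuousMap Z ℝ →ₗ[ℝ] ℝ :=
    { toFun := fun g => (inner ℂ x (π (ι g) x)).re
      map_add' := fun g h => by
        have : ι (g + h) = ι g + ι h := by ext z; simp [ι]
        simp [this]
      map_smul' := fun c g => by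
        have : ι (c • g) = (c : ℂ) • ι g := by ext z; simp [ι]
        simp only [this, map_smul, smul_apply, inner_smul_right,
          Complex.re_ofReal_mul, smul_eq_mul, RingHom.id_apply] }
  let Λ : CompactlySupportedContinuousMap Z ℝ →ₚ[ℝ] ℝ := PositiveLinearMap.mk₀ Λ₀ (by
    intro g hg
    -- Positivity: a nonnegative `g` is `star h * h` with `h = √g`.
    let h : C(Z, ℂ) := ⟨fun z => (Real.sqrt (g z) : ℂ), by fun_prop⟩
    have : ι g = star h * h := by
      ext z
      have h0 : 0 ≤ g z := hg z
      simp only [ι, h, ContinuousMap.coe_mk, ContinuousMap.mul_apply, ContinuousMap.star_apply,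
        RCLike.star_def, Complex.conj_ofReal, ← Complex.ofReal_mul, Real.mul_self_sqrt h0]
    change 0 ≤ (inner ℂ x (π (ι g) x)).re
    rw [this, ← StarAlgHom.norm_apply_sq]
    positivity)
  refine ⟨RealRMK.rieszMeasure Λ, inferInstance, fun φ => ?_⟩
  let g : CompactlySupportedContinuousMap Z ℝ :=
    ⟨⟨fun z => ‖φ z‖ ^ 2, by fun_prop⟩, HasCompactSupport.of_compactSpace _⟩
  have h1 := RealRMK.integral_rieszMeasure Λ g
  have h2 : ι g = star φ * φ := by
    ext z
    change ((‖φ z‖ ^ 2 : ℝ) : ℂ) = (starRingEnd ℂ) (φ z) * φ z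
    rw [mul_comm, Complex.mul_conj, Complex.normSq_eq_norm_sq]
  rw [StarAlgHom.norm_apply_sq, ← h2]
  exact h1

theorem Set.Countable.of_pairwise_one_le_dist {α : Type*} [PseudoMetricSpace α]
    [TopologicalSpace.SeparableSpace α] {s : Set α}
    (hs : ∀ x ∈ s, ∀ y ∈ s, x ≠ y → 1 ≤ dist x y) : s.Countable := by
  refine Set.PairwiseDisjoint.countable_of_isOpen (s := fun x => Metric.ball x (1 / 2)) ?_
    (fun _ _ => Metric.isOpen_ball) (fun x _ => ⟨x, Metric.mem_ball_self (by norm_num)⟩)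
  intro x hx y hy hxy
  refine Metric.ball_disjoint_ball ?_
  linarith [hs x hx y hy hxy]

/-- A set of unit vectors generating mutually orthogonal cyclic subspaces. -/
def IsCyclicFamily (π : C(Z, ℂ) →⋆ₐ[ℂ] (H →L[ℂ] H)) (S : Set H) : Prop :=
  (∀ x ∈ S, ‖x‖ = 1) ∧ ∀ x ∈ S, ∀ y ∈ S, x ≠ y → ∀ φ, inner ℂ (π φ x) y = 0

/-- Taking `φ = 1`, distinct members are orthonormal, hence at distance `√2`. -/
theorem IsCyclicFamily.countable [TopologicalSpace.SeparableSpace H]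
    {π : C(Z, ℂ) →⋆ₐ[ℂ] (H →L[ℂ] H)} {S : Set H} (hS : IsCyclicFamily π S) : S.Countable := by
  refine Set.Countable.of_pairwise_one_le_dist fun x hx y hy hxy => ?_
  have h := hS.2 x hx y hy hxy 1
  rw [map_one, one_apply_eq_self] at h
  have h1 := norm_sub_sq (𝕜 := ℂ) x y
  rw [h, hS.1 x hx, hS.1 y hy] at h1
  simp only [map_zero] at h1
  rw [dist_eq_norm]
  nlinarith [norm_nonneg (x - y)]

/-- Take `S` maximal: a nonzero `v` violating totality could be normalised and added to it. -/
theorem exists_isCyclicFamily_total (π : C(Z, ℂ) →⋆ₐ[ℂ] (H →L[ℂ] H)) :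
    ∃ S : Set H, IsCyclicFamily π S ∧
      ∀ v : H, (∀ x ∈ S, ∀ φ, inner ℂ (π φ x) v = 0) → v = 0 := by
  obtain ⟨S, hS⟩ := zorn_subset {S | IsCyclicFamily π S} (by
    intro c hc hchain
    refine ⟨⋃₀ c, ⟨?_, ?_⟩, fun s hs => Set.subset_sUnion_of_mem hs⟩
    · rintro x ⟨s, hs, hx⟩
      exact (hc hs).1 x hx
    · rintro x ⟨s, hs, hx⟩ y ⟨t, ht, hy⟩
      rcases hchain.total hs ht with h | h
      · exact (hc ht).2 x (h hx) y hy
      · exact (hc hs).2 x hx y (h hy))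
  refine ⟨S, hS.prop, fun v hv => ?_⟩
  by_contra hv0
  set w : H := ((‖v‖⁻¹ : ℝ) : ℂ) • v with hw
  have hw1 : ‖w‖ = 1 := by
    rw [hw, norm_smul, Complex.norm_real, norm_inv, norm_norm,
      inv_mul_cancel₀ (norm_ne_zero_iff.2 hv0)]
  have hwS : ∀ x ∈ S, ∀ φ, inner ℂ (π φ x) w = 0 := fun x hx φ => by
    rw [hw, inner_smul_right, hv x hx φ, mul_zero]
  have hins : IsCyclicFamily π (insert w S) := by
    refine ⟨?_, ?_⟩
    · rintro x (rfl | hx)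
      · exact hw1
      · exact hS.prop.1 x hx
    · rintro x (rfl | hx) y (rfl | hy) hxy φ
      · exact absurd rfl hxy
      · rw [StarAlgHom.inner_apply_left, ← inner_conj_symm, hwS y hy, map_zero]
      · exact hwS x hx φ
      · exact hS.prop.2 x hx y hy hxy φ
  have hmem : w ∈ S := hS.le_of_ge hins (Set.subset_insert w S) (Set.mem_insert w S)
  have h := hwS w hmem 1
  rw [map_one, one_apply_eq_self, inner_self_eq_zero] at h
  rw [h, norm_zero] at hw1
  exact zero_ne_one hw1

/-- A sequence of vectors, with geometrically decaying norms, generating mutually orthogonal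
cyclic subspaces whose sum is dense. -/
theorem exists_cyclic_sequence [TopologicalSpace.SeparableSpace H]
    (π : C(Z, ℂ) →⋆ₐ[ℂ] (H →L[ℂ] H)) :
    ∃ x : ℕ → H, (∀ n, ‖x n‖ ≤ (1 / 2) ^ n) ∧
      (∀ m n, m ≠ n → ∀ φ ψ, inner ℂ (π φ (x m)) (π ψ (x n)) = 0) ∧
      ∀ v : H, (∀ n φ, inner ℂ (π φ (x n)) v = 0) → v = 0 := by
  obtain ⟨S, hS, htot⟩ := exists_isCyclicFamily_total π
  have := hS.countable.to_subtype
  let _ : Encodable S := Encodable.ofCountable S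
  -- Indices that encode no element of `S` carry the vector `0`, which harms neither orthogonality
  -- nor totality.
  let y : ℕ → H := fun n => (Encodable.decode₂ S n).elim 0 (fun s => (s : H))
  have hy : ∀ n, y n = 0 ∨ ∃ s : S, y n = s ∧ Encodable.encode s = n := by
    intro n
    cases h : Encodable.decode₂ S n with
    | none => exact Or.inl (by simp [y, h])
    | some s => exact Or.inr ⟨s, by simp [y, h], Encodable.mem_decode₂.1 h⟩
  let c : ℕ → ℂ := fun n => (1 / 2) ^ n
  refine ⟨fun n => c n • y n, fun n => ?_, fun m n hmn φ ψ => ?_, fun v hv => ?_⟩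
  · have hyn : ‖y n‖ ≤ 1 := by
      rcases hy n with h | ⟨s, h, -⟩
      · simp [h]
      · rw [h, hS.1 s s.2]
    have hc : ‖c n‖ = (1 / 2) ^ n := by simp [c]
    rw [norm_smul, hc]
    exact mul_le_of_le_one_right (by positivity) hyn
  · have : inner ℂ (π φ (y m)) (π ψ (y n)) = 0 := by
      rcases hy m with h | ⟨s, h, hs⟩
      · simp [h]
      rcases hy n with h' | ⟨t, h', ht⟩
      · simp [h']
      have hst : (s : H) ≠ t := fun e => hmn (by rw [← hs, ← ht, Subtype.ext e])
      have h0 := hS.2 s s.2 t t.2 hst (star ψ * φ)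
      rwa [map_mul, mul_apply_eq_comp, StarAlgHom.inner_apply_left, star_star,
        ← h, ← h'] at h0
    simp only [map_smul, inner_smul_left, inner_smul_right, this, mul_zero]
  · refine htot v fun s hs φ => ?_
    have h := hv (Encodable.encode (⟨s, hs⟩ : S)) φ
    have hys : y (Encodable.encode (⟨s, hs⟩ : S)) = s := by simp [y, Encodable.decode₂_encode]
    have hc : (starRingEnd ℂ) (c (Encodable.encode (⟨s, hs⟩ : S))) ≠ 0 := by simp [c]
    simp only [hys, map_smul, inner_smul_left] at h
    exact (mul_eq_zero.1 h).resolve_left hc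

end CyclicVectors

/-! ### Measures on `ℕ × Z` -/

section NatSum

variable {Z : Type*} [MeasurableSpace Z]

/-- The measure on `ℕ × Z` which restricts to `ν n` on the `n`-th copy of `Z`. -/
noncomputable def MeasureTheory.Measure.natSum (ν : ℕ → Measure Z) : Measure (ℕ × Z) :=
  Measure.sum fun n => (ν n).map (Prod.mk n)

theorem MeasureTheory.Measure.isFiniteMeasure_natSum (ν : ℕ → Measure Z)
    [∀ n, IsFiniteMeasure (ν n)] (h : Summable fun n => (ν n).real Set.univ) :
    IsFiniteMeasure (Measure.natSum ν) := by
  constructor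
  rw [Measure.natSum, Measure.sum_apply _ MeasurableSet.univ]
  have : ∀ n, ((ν n).map (Prod.mk n)) Set.univ = ENNReal.ofReal ((ν n).real Set.univ) := fun n => by
    rw [Measure.map_apply (by fun_prop) MeasurableSet.univ, Set.preimage_univ, ofReal_measureReal]
  simp only [this]
  exact h.tsum_ofReal_lt_top

theorem MeasureTheory.Measure.hasSum_integral_natSum (ν : ℕ → Measure Z) {F : ℕ × Z → ℝ}
    (hF : Integrable F (Measure.natSum ν)) :
    HasSum (fun n => ∫ z, F (n, z) ∂ν n) (∫ y, F y ∂Measure.natSum ν) := by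
  have h := hasSum_integral_measure hF
  convert! h using 2 with n
  refine (integral_map (by fun_prop) ?_).symm
  exact (hF.mono_measure (Measure.le_sum _ n)).aestronglyMeasurable

end NatSum

/-! ### Summing the cyclic pieces -/

section Representation

open BoundedContinuousFunction

/-- The restriction of a bounded continuous function on `ℕ × Z` to a copy of `Z`. -/
noncomputable def BoundedContinuousFunction.slice {Z : Type*} [TopologicalSpace Z]
    (φ : ℕ × Z →ᵇ ℂ) (n : ℕ) : C(Z, ℂ) :=
  ⟨fun z => φ (n, z), by fun_prop⟩

/-- The function on `ℕ × Z` equal to `ψ` on the `n`-th copy of `Z` and to `0` elsewhere. -/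
noncomputable def BoundedContinuousFunction.single {Z : Type*} [TopologicalSpace Z]
    [CompactSpace Z] (n : ℕ) (ψ : C(Z, ℂ)) : ℕ × Z →ᵇ ℂ :=
  BoundedContinuousFunction.ofNormedAddCommGroup (fun y => if y.1 = n then ψ y.2 else 0)
    (by
      refine Continuous.if (fun y hy => ?_) (by fun_prop) continuous_const
      have : IsClopen {y : ℕ × Z | y.1 = n} :=
        (isClopen_discrete ({n} : Set ℕ)).preimage continuous_fst
      rw [this.frontier_eq] at hy
      exact hy.elim)
    ‖ψ‖ (fun y => by
      split_ifs
      · exact ψ.norm_coe_le_norm _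
      · simp)

theorem BoundedContinuousFunction.slice_single_self {Z : Type*} [TopologicalSpace Z]
    [CompactSpace Z] (n : ℕ) (ψ : C(Z, ℂ)) : (single n ψ).slice n = ψ := by
  ext z
  simp [single, slice]

theorem BoundedContinuousFunction.slice_single_of_ne {Z : Type*} [TopologicalSpace Z]
    [CompactSpace Z] {m n : ℕ} (h : m ≠ n) (ψ : C(Z, ℂ)) : (single n ψ).slice m = 0 := by
  ext z
  simp [single, slice, h]

theorem BoundedContinuousFunction.norm_slice_le {Z : Type*} [TopologicalSpace Z]
    [CompactSpace Z] (φ : ℕ × Z →ᵇ ℂ) (n : ℕ) : ‖φ.slice n‖ ≤ ‖φ‖ :=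
  (ContinuousMap.norm_le _ (norm_nonneg φ)).2 fun z => φ.norm_coe_le_norm (n, z)

theorem BoundedContinuousFunction.norm_toLp_sq {Y : Type*} [TopologicalSpace Y]
    [SecondCountableTopology Y] [MeasurableSpace Y] [BorelSpace Y] (μ : Measure Y)
    [IsFiniteMeasure μ] (φ : Y →ᵇ ℂ) :
    ‖BoundedContinuousFunction.toLp 2 μ ℂ φ‖ ^ 2 = ∫ y, ‖φ y‖ ^ 2 ∂μ := by
  have h : ((‖BoundedContinuousFunction.toLp 2 μ ℂ φ‖ ^ 2 : ℝ) : ℂ) =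
      ((∫ y, ‖φ y‖ ^ 2 ∂μ : ℝ) : ℂ) := by
    have h1 := inner_self_eq_norm_sq_to_K (𝕜 := ℂ) (BoundedContinuousFunction.toLp 2 μ ℂ φ)
    rw [L2.inner_def] at h1
    rw [← integral_complex_ofReal, Complex.ofReal_pow]
    refine h1.symm.trans (integral_congr_ae ?_)
    filter_upwards [BoundedContinuousFunction.coeFn_toLp 2 μ ℂ φ] with y hy
    rw [hy, inner_self_eq_norm_sq_to_K]
    simp
  exact_mod_cast h

theorem HasSum.norm_sq_of_orthogonal {H : Type*} [NormedAddCommGroup H]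
    [InnerProductSpace ℂ H] {a : ℕ → H} {s : H} (hs : HasSum a s)
    (ha : ∀ m n, m ≠ n → inner ℂ (a m) (a n) = 0) : HasSum (fun n => ‖a n‖ ^ 2) (‖s‖ ^ 2) := by
  have h1 : ∀ n, inner ℂ (a n) s = ((‖a n‖ ^ 2 : ℝ) : ℂ) := fun n => by
    have h := hs.mapL (innerSL ℂ (a n))
    simp only [innerSL_apply_apply] at h
    refine h.unique ?_
    convert! hasSum_single n fun m hm => ha n m hm.symm using 1
    rw [inner_self_eq_norm_sq_to_K]
    simp
  have h2 := hs.mapL (innerSL ℂ s)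
  simp only [innerSL_apply_apply] at h2
  have h3 : ∀ n, inner ℂ s (a n) = ((‖a n‖ ^ 2 : ℝ) : ℂ) := fun n => by
    rw [← inner_conj_symm, h1, Complex.conj_ofReal]
  have h4 : inner ℂ s s = ((‖s‖ ^ 2 : ℝ) : ℂ) := by
    rw [inner_self_eq_norm_sq_to_K]
    simp
  simp only [h3, h4] at h2
  exact_mod_cast h2

variable {H : Type*} [NormedAddCommGroup H] [InnerProductSpace ℂ H] [CompleteSpace H]

variable {Z : Type*} [TopologicalSpace Z] [CompactSpace Z]

theorem summable_slice_apply (π : C(Z, ℂ) →⋆ₐ[ℂ] (H →L[ℂ] H)) {x : ℕ → H}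
    (hx : ∀ n, ‖x n‖ ≤ (1 / 2) ^ n) (φ : ℕ × Z →ᵇ ℂ) :
    Summable fun n => π (φ.slice n) (x n) := by
  refine Summable.of_norm_bounded (g := fun n => ‖φ‖ * (1 / 2 : ℝ) ^ n)
    (summable_geometric_two.mul_left _) fun n => ?_
  calc ‖π (φ.slice n) (x n)‖ ≤ ‖π (φ.slice n)‖ * ‖x n‖ := ContinuousLinearMap.le_opNorm _ _
    _ ≤ ‖φ‖ * (1 / 2) ^ n := by
      refine mul_le_mul ?_ (hx n) (norm_nonneg _) (norm_nonneg _)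
      exact (NonUnitalStarAlgHom.norm_apply_le π _).trans (φ.norm_slice_le n)

/-- The map `φ ↦ ∑ₙ π (φ (n, ·)) xₙ`. -/
noncomputable def cyclicSum (π : C(Z, ℂ) →⋆ₐ[ℂ] (H →L[ℂ] H)) {x : ℕ → H}
    (hx : ∀ n, ‖x n‖ ≤ (1 / 2) ^ n) : (ℕ × Z →ᵇ ℂ) →ₗ[ℂ] H where
  toFun φ := ∑' n, π (φ.slice n) (x n)
  map_add' φ ψ := by
    rw [← (summable_slice_apply π hx φ).tsum_add (summable_slice_apply π hx ψ)]
    refine tsum_congr fun n => ?_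
    have : (φ + ψ).slice n = φ.slice n + ψ.slice n := rfl
    rw [this, map_add, _root_.add_apply]
  map_smul' c φ := by
    rw [RingHom.id_apply, ← (summable_slice_apply π hx φ).tsum_const_smul c]
    refine tsum_congr fun n => ?_
    have : (c • φ).slice n = c • φ.slice n := rfl
    rw [this, map_smul, _root_.smul_apply]

theorem cyclicSum_mul (π : C(Z, ℂ) →⋆ₐ[ℂ] (H →L[ℂ] H)) {x : ℕ → H}
    (hx : ∀ n, ‖x n‖ ≤ (1 / 2) ^ n) (g : C(Z, ℂ)) (φ ψ : ℕ × Z →ᵇ ℂ)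
    (h : ∀ y, ψ y = g y.2 * φ y) : cyclicSum π hx ψ = π g (cyclicSum π hx φ) := by
  change ∑' n, π (ψ.slice n) (x n) = π g (∑' n, π (φ.slice n) (x n))
  rw [ContinuousLinearMap.map_tsum _ (summable_slice_apply π hx φ)]
  refine tsum_congr fun n => ?_
  have : ψ.slice n = g * φ.slice n := by
    ext z
    exact h (n, z)
  rw [this, map_mul, mul_apply_eq_comp]

theorem cyclicSum_single (π : C(Z, ℂ) →⋆ₐ[ℂ] (H →L[ℂ] H)) {x : ℕ → H}
    (hx : ∀ n, ‖x n‖ ≤ (1 / 2) ^ n) (n : ℕ) (ψ : C(Z, ℂ)) :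
    cyclicSum π hx (single n ψ) = π ψ (x n) := by
  change ∑' m, π ((single n ψ).slice m) (x m) = _
  rw [tsum_eq_single n fun m hm => by simp [slice_single_of_ne hm], slice_single_self]

/-- Functions supported on one copy of `Z` already produce every `π φ (x n)`, so only `0` is
orthogonal to the range. -/
theorem denseRange_cyclicSum (π : C(Z, ℂ) →⋆ₐ[ℂ] (H →L[ℂ] H)) {x : ℕ → H}
    (hx : ∀ n, ‖x n‖ ≤ (1 / 2) ^ n)
    (htot : ∀ v : H, (∀ n φ, inner ℂ (π φ (x n)) v = 0) → v = 0) :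
    DenseRange (cyclicSum π hx) := by
  have h : (LinearMap.range (cyclicSum π hx)).topologicalClosure = ⊤ := by
    rw [Submodule.topologicalClosure_eq_top_iff, Submodule.eq_bot_iff]
    intro v hv
    refine htot v fun n φ => ?_
    rw [← cyclicSum_single π hx]
    exact hv _ ⟨_, rfl⟩
  exact Submodule.dense_iff_topologicalClosure_eq_top.2 h

end Representation

/-! ### Spectral theorem for bounded normal operators -/

section SpectralTheorem

theorem exists_linearIsometryEquiv_of_denseRange {E F G : Type*} [AddCommGroup E] [Module ℂ E]
    [NormedAddCommGroup F] [NormedSpace ℂ F] [CompleteSpace F]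
    [NormedAddCommGroup G] [NormedSpace ℂ G] [CompleteSpace G]
    (e₁ : E →ₗ[ℂ] F) (e₂ : E →ₗ[ℂ] G) (h₁ : DenseRange e₁) (h₂ : DenseRange e₂)
    (hnorm : ∀ x, ‖e₂ x‖ = ‖e₁ x‖) : ∃ U : F ≃ₗᵢ[ℂ] G, ∀ x, U (e₁ x) = e₂ x :=
  ⟨(LinearEquiv.refl ℂ E).extendOfIsometry e₁ e₂ h₁ h₂ hnorm,
    fun x => LinearEquiv.extendOfIsometry_eq _ _ _ h₁ h₂ hnorm x⟩

variable {H : Type*} [NormedAddCommGroup H] [InnerProductSpace ℂ H] [CompleteSpace H]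
  {Z : Type*} [MetricSpace Z] [CompactSpace Z] [MeasurableSpace Z] [BorelSpace Z]

open BoundedContinuousFunction

/-- Glue the spectral measures of the `x n`: slice by slice, both squared norms are sums of the same
series. -/
theorem exists_measure_norm_cyclicSum (π : C(Z, ℂ) →⋆ₐ[ℂ] (H →L[ℂ] H)) {x : ℕ → H}
    (hx : ∀ n, ‖x n‖ ≤ (1 / 2) ^ n)
    (horth : ∀ m n, m ≠ n → ∀ φ ψ, inner ℂ (π φ (x m)) (π ψ (x n)) = 0) :
    ∃ (μ : Measure (ℕ × Z)) (_ : IsFiniteMeasure μ),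
      ∀ φ, ‖toLp 2 μ ℂ φ‖ = ‖cyclicSum π hx φ‖ := by
  choose ν hfin hν using fun n => exists_spectralMeasure π (x n)
  have hμ : IsFiniteMeasure (Measure.natSum ν) := by
    refine Measure.isFiniteMeasure_natSum ν ?_
    refine Summable.of_nonneg_of_le (fun _ => measureReal_nonneg) (fun n => ?_)
      summable_geometric_two
    -- The constant function 1 gives the total mass `‖x n‖²` of `ν n`.
    have h := hν n 1
    simp only [ContinuousMap.one_apply, norm_one, one_pow, integral_const, smul_eq_mul, mul_one,
      map_one, one_apply_eq_self] at h
    rw [h]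
    have h1 : ‖x n‖ ≤ 1 := (hx n).trans (pow_le_one₀ (by norm_num) (by norm_num))
    nlinarith [hx n, norm_nonneg (x n)]
  refine ⟨Measure.natSum ν, hμ, fun φ => ?_⟩
  refine (sq_eq_sq₀ (norm_nonneg _) (norm_nonneg _)).1 ?_
  have h1 := (summable_slice_apply π hx φ).hasSum.norm_sq_of_orthogonal
    fun m n hmn => horth m n hmn _ _
  have hint : Integrable (fun y => ‖φ y‖ ^ 2) (Measure.natSum ν) := by
    refine Integrable.of_bound (φ.continuous.norm.pow 2).aestronglyMeasurable (‖φ‖ ^ 2)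
      (Filter.Eventually.of_forall fun y => ?_)
    rw [norm_pow, norm_norm]
    exact pow_le_pow_left₀ (norm_nonneg _) (φ.norm_coe_le_norm y) 2
  have h2 := Measure.hasSum_integral_natSum ν hint
  rw [norm_toLp_sq]
  refine h2.unique ?_
  convert! h1 using 2 with n
  exact hν n (φ.slice n)

theorem exists_unitary_cyclicSum (π : C(Z, ℂ) →⋆ₐ[ℂ] (H →L[ℂ] H)) {x : ℕ → H}
    (hx : ∀ n, ‖x n‖ ≤ (1 / 2) ^ n)
    (htot : ∀ v : H, (∀ n φ, inner ℂ (π φ (x n)) v = 0) → v = 0)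
    (μ : Measure (ℕ × Z)) [IsFiniteMeasure μ]
    (hnorm : ∀ φ, ‖toLp 2 μ ℂ φ‖ = ‖cyclicSum π hx φ‖) :
    ∃ U : H ≃ₗᵢ[ℂ] Lp ℂ 2 μ, ∀ φ, U (cyclicSum π hx φ) = toLp 2 μ ℂ φ := by
  exact exists_linearIsometryEquiv_of_denseRange (cyclicSum π hx) (toLp 2 μ ℂ).toLinearMap
    (denseRange_cyclicSum π hx htot) (toLp_denseRange ℂ μ ℂ (by simp)) hnorm

theorem memLp_comp_snd_mul {μ : Measure (ℕ × Z)} (g : C(Z, ℂ)) (w : Lp ℂ 2 μ) :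
    MemLp (fun y : ℕ × Z => g y.2 * w y) 2 μ := by
  refine MemLp.of_le_mul (c := ‖g‖) (Lp.memLp w) ?_ (Filter.Eventually.of_forall fun y => ?_)
  · exact (g.continuous.comp continuous_snd).aestronglyMeasurable.mul (Lp.aestronglyMeasurable _)
  · rw [norm_mul]
    exact mul_le_mul_of_nonneg_right (g.norm_coe_le_norm _) (norm_nonneg _)

/-- Test against the dense bounded continuous functions, moving `g` to the other side of the inner
product as `star g`. -/
theorem unitary_apply_ae_eq_mul (π : C(Z, ℂ) →⋆ₐ[ℂ] (H →L[ℂ] H)) {x : ℕ → H}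
    (hx : ∀ n, ‖x n‖ ≤ (1 / 2) ^ n) {μ : Measure (ℕ × Z)} [IsFiniteMeasure μ]
    {U : H ≃ₗᵢ[ℂ] Lp ℂ 2 μ} (hU : ∀ φ, U (cyclicSum π hx φ) = toLp 2 μ ℂ φ)
    (g : C(Z, ℂ)) (v : H) : U (π g v) =ᵐ[μ] fun y => g y.2 * U v y := by
  have hmem := memLp_comp_snd_mul g (U v)
  have hkey : U (π g v) = hmem.toLp _ := by
    refine (toLp_denseRange ℂ μ ℂ (by simp)).eq_of_inner_right ℂ ?_
    intro φ
    let G : ℕ × Z →ᵇ ℂ := (mkOfCompact (star g)).compContinuous ⟨Prod.snd, continuous_snd⟩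
    have h1 : cyclicSum π hx (G * φ) = π (star g) (cyclicSum π hx φ) :=
      cyclicSum_mul π hx _ _ _ fun y => rfl
    have h2 := π.inner_apply_left (star g) (cyclicSum π hx φ) v
    rw [star_star] at h2
    rw [← hU φ, LinearIsometryEquiv.inner_map_map, ← h2, ← h1, ← LinearIsometryEquiv.inner_map_map U,
      hU, hU, L2.inner_def, L2.inner_def]
    refine integral_congr_ae ?_
    filter_upwards [hmem.coeFn_toLp, coeFn_toLp 2 μ ℂ φ, coeFn_toLp 2 μ ℂ (G * φ)] with y h2 h3 h4
    have hG : (starRingEnd ℂ) (G y) = g y.2 := Complex.conj_conj _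
    simp only [h2, h3, h4, RCLike.inner_apply, BoundedContinuousFunction.mul_apply,
      map_mul, hG]
    ring
  rw [hkey]
  exact hmem.coeFn_toLp

/-- Every representation of `C(Z, ℂ)` on a separable Hilbert space is unitarily equivalent to a
representation by multiplication operators. -/
theorem exists_unitary_of_starAlgHom [TopologicalSpace.SeparableSpace H]
    (π : C(Z, ℂ) →⋆ₐ[ℂ] (H →L[ℂ] H)) :
    ∃ (μ : Measure (ℕ × Z)) (_ : IsFiniteMeasure μ) (U : H ≃ₗᵢ[ℂ] Lp ℂ 2 μ),
      ∀ (g : C(Z, ℂ)) (v : H), U (π g v) =ᵐ[μ] fun y => g y.2 * U v y := by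
  obtain ⟨x, hx, horth, htot⟩ := exists_cyclic_sequence π
  obtain ⟨μ, hμ, hnorm⟩ := exists_measure_norm_cyclicSum π hx horth
  obtain ⟨U, hU⟩ := exists_unitary_cyclicSum π hx htot μ hnorm
  exact ⟨μ, hμ, U, unitary_apply_ae_eq_mul π hx hU⟩

/-- The spectral theorem for bounded normal operators on a separable Hilbert space. -/
theorem IsStarNormal.exists_unitary [TopologicalSpace.SeparableSpace H] {T : H →L[ℂ] H}
    (hT : IsStarNormal T) :
    ∃ (μ : Measure (ℕ × spectrum ℂ T)) (_ : IsFiniteMeasure μ) (U : H ≃ₗᵢ[ℂ] Lp ℂ 2 μ),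
      ∀ v : H, U (T v) =ᵐ[μ] fun y => (y.2 : ℂ) * U v y := by
  have : CompactSpace (spectrum ℂ T) := isCompact_iff_compactSpace.1 (spectrum.isCompact T)
  obtain ⟨μ, hμ, U, h⟩ := exists_unitary_of_starAlgHom (cfcHom (R := ℂ) hT)
  refine ⟨μ, hμ, U, fun v => ?_⟩
  have h1 := h (ContinuousMap.restrict (spectrum ℂ T) (ContinuousMap.id ℂ)) v
  rw [cfcHom_id hT] at h1
  exact h1

end SpectralTheorem

/-! ### Resolvents of an unbounded self-adjoint operator -/

section Resolvent

variable {H : Type*} [NormedAddCommGroup H] [InnerProductSpace ℂ H] [CompleteSpace H]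
  {A : H →ₗ.[ℂ] H}

open Complex

theorem IsSelfAdjoint.inner_pmap_apply (hA : IsSelfAdjoint A) (u v : A.domain) :
    inner ℂ (A u) (v : H) = inner ℂ (u : H) (A v) := by
  have h := LinearPMap.adjoint_isFormalAdjoint hA.dense_domain
  rw [LinearPMap.isSelfAdjoint_def.1 hA] at h
  exact h u v

/-- The cross term vanishes: `⟪A v, v⟫` is real and `z` is imaginary. -/
theorem IsSelfAdjoint.norm_pmap_add_smul_sq (hA : IsSelfAdjoint A) {z : ℂ}
    (hz : starRingEnd ℂ z = -z) (hz1 : ‖z‖ = 1) (v : A.domain) :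
    ‖A v + z • (v : H)‖ ^ 2 = ‖A v‖ ^ 2 + ‖(v : H)‖ ^ 2 := by
  have h : (inner ℂ (A v) (z • (v : H))).re = 0 := by
    have h1 : starRingEnd ℂ (inner ℂ (A v) (z • (v : H))) = -inner ℂ (A v) (z • (v : H)) := by
      rw [inner_smul_right, map_mul, hz, inner_conj_symm, hA.inner_pmap_apply, neg_mul]
    have h2 := congrArg Complex.re h1
    rw [conj_re, neg_re] at h2
    linarith
  rw [norm_add_sq (𝕜 := ℂ), norm_smul, hz1, one_mul]
  change _ + 2 * (inner ℂ (A v) (z • (v : H))).re + _ = _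
  rw [h, mul_zero, add_zero]

theorem IsSelfAdjoint.norm_le_norm_pmap_add_smul (hA : IsSelfAdjoint A) {z : ℂ}
    (hz : starRingEnd ℂ z = -z) (hz1 : ‖z‖ = 1) (v : A.domain) :
    ‖(v : H)‖ ≤ ‖A v + z • (v : H)‖ :=
  le_of_sq_le_sq (by rw [hA.norm_pmap_add_smul_sq hz hz1]; nlinarith [sq_nonneg ‖A v‖])
    (norm_nonneg _)

/-- The range is closed, because the graph of `A` is complete and `A + z` is bounded below in the
graph norm. It is dense: a vector `u` orthogonal to it satisfies `A* u = z u`, so `(A - z) u = 0`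
and the lower bound for `-z` gives `u = 0`. -/
theorem IsSelfAdjoint.exists_pmap_add_smul_eq (hA : IsSelfAdjoint A) {z : ℂ}
    (hz : starRingEnd ℂ z = -z) (hz1 : ‖z‖ = 1) (w : H) :
    ∃ v : A.domain, A v + z • (v : H) = w := by
  let L : A.graph →L[ℂ] H :=
    (ContinuousLinearMap.snd ℂ H H + z • ContinuousLinearMap.fst ℂ H H).comp A.graph.subtypeL
  have hL : ∀ v : A.domain, ∃ p : A.graph, L p = A v + z • (v : H) := fun v =>
    ⟨⟨(v, A v), A.mem_graph v⟩, rfl⟩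
  have hanti : AntilipschitzWith 1 L := by
    refine ContinuousLinearMap.antilipschitz_of_bound L fun p => ?_
    obtain ⟨⟨a, b⟩, hp⟩ := p
    obtain ⟨v, hv1, hv2⟩ := (LinearPMap.mem_graph_iff A).1 hp
    dsimp only at hv1 hv2
    subst hv1 hv2
    have h := hA.norm_pmap_add_smul_sq hz hz1 v
    change max ‖(v : H)‖ ‖A v‖ ≤ (1 : NNReal) * ‖A v + z • (v : H)‖
    rw [NNReal.coe_one, one_mul]
    refine max_le (hA.norm_le_norm_pmap_add_smul hz hz1 v) ?_
    exact le_of_sq_le_sq (by rw [h]; nlinarith [sq_nonneg ‖(v : H)‖]) (norm_nonneg _)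
  have : CompleteSpace A.graph := hA.isClosed.completeSpace_coe
  have hclosed : IsClosed (LinearMap.range L.toLinearMap : Set H) :=
    hanti.isClosed_range L.uniformContinuous
  have hrange : LinearMap.range L.toLinearMap = ⊤ := by
    rw [← hclosed.submodule_topologicalClosure_eq, Submodule.topologicalClosure_eq_top_iff,
      Submodule.eq_bot_iff]
    intro u hu
    have hu' : ∀ x : A.domain, inner ℂ (z • u) (x : H) = inner ℂ u (A x) := fun x => by
      obtain ⟨p, hp⟩ := hL x
      have h := (Submodule.mem_orthogonal' _ _).1 hu (L p) ⟨p, rfl⟩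
      rw [hp, inner_add_right, inner_smul_right] at h
      rw [inner_smul_left, hz]
      linear_combination -h
    have hdom := LinearPMap.mem_adjoint_domain_of_exists (T := A) u ⟨z • u, hu'⟩
    have hval := LinearPMap.adjoint_apply_eq hA.dense_domain ⟨u, hdom⟩ hu'
    have hdom' : u ∈ A.domain := by rwa [LinearPMap.isSelfAdjoint_def.1 hA] at hdom
    have hval' : A ⟨u, hdom'⟩ = z • u := by
      rw [← hval]
      exact (@(LinearPMap.ext_iff.1 (LinearPMap.isSelfAdjoint_def.1 hA)).2 u hdom hdom').symm
    have h := hA.norm_le_norm_pmap_add_smul (z := -z) (by rw [map_neg, hz])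
      (by rw [norm_neg, hz1]) ⟨u, hdom'⟩
    rw [hval', neg_smul, add_neg_cancel, norm_zero] at h
    exact norm_le_zero_iff.1 h
  obtain ⟨⟨⟨a, b⟩, hp⟩, hw⟩ : w ∈ LinearMap.range L.toLinearMap := hrange ▸ Submodule.mem_top
  obtain ⟨v, hv1, hv2⟩ := (LinearPMap.mem_graph_iff A).1 hp
  dsimp only at hv1 hv2
  subst hv1 hv2
  exact ⟨v, hw⟩

/-- The bounded inverse of `A + z` for a self-adjoint operator `A` and `z = ± i`. -/
theorem IsSelfAdjoint.exists_resolvent (hA : IsSelfAdjoint A) {z : ℂ}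
    (hz : starRingEnd ℂ z = -z) (hz1 : ‖z‖ = 1) :
    ∃ T : H →L[ℂ] H, (∀ w, ∃ v : A.domain, T w = v ∧ A v + z • (v : H) = w) ∧
      ∀ v : A.domain, T (A v + z • (v : H)) = v := by
  let L : A.domain →ₗ[ℂ] H := A.toFun + z • A.domain.subtype
  have hLv : ∀ v, L v = A v + z • (v : H) := fun _ => rfl
  have hinj : Function.Injective L := by
    rw [injective_iff_map_eq_zero]
    intro v hv
    have h := hA.norm_le_norm_pmap_add_smul hz hz1 v
    rw [← hLv, hv, norm_zero] at h
    exact Subtype.ext (norm_le_zero_iff.1 h)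
  let e : A.domain ≃ₗ[ℂ] H :=
    LinearEquiv.ofBijective L ⟨hinj, hA.exists_pmap_add_smul_eq hz hz1⟩
  have he : ∀ v, e v = A v + z • (v : H) := fun _ => rfl
  let T : H →L[ℂ] H := (A.domain.subtype ∘ₗ e.symm.toLinearMap).mkContinuous 1 fun w => by
    have h := hA.norm_le_norm_pmap_add_smul hz hz1 (e.symm w)
    rw [← he, e.apply_symm_apply] at h
    rwa [one_mul]
  refine ⟨T, fun w => ⟨e.symm w, rfl, ?_⟩, fun v => ?_⟩
  · rw [← he, e.apply_symm_apply]
  · change ((e.symm (A v + z • (v : H)) : A.domain) : H) = v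
    rw [← he, e.symm_apply_apply]

/-- The resolvent `T = (A + i)⁻¹` of a self-adjoint operator satisfies
`T* - T = 2 i T* T = 2 i T T*`. -/
theorem IsSelfAdjoint.exists_resolvent_I (hA : IsSelfAdjoint A) :
    ∃ T : H →L[ℂ] H, (∀ w, ∃ v : A.domain, T w = v ∧ A v + I • (v : H) = w) ∧
      (∀ v : A.domain, T (A v + I • (v : H)) = v) ∧
      star T - T = (2 * I) • (star T * T) ∧ star T - T = (2 * I) • (T * star T) := by
  obtain ⟨T, hT1, hT2⟩ := hA.exists_resolvent conj_I norm_I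
  obtain ⟨S, hS1, hS2⟩ := hA.exists_resolvent (z := -I) (by rw [map_neg, conj_I])
    (by rw [norm_neg, norm_I])
  have hST : star T = S := by
    rw [ContinuousLinearMap.star_eq_adjoint]
    refine ((ContinuousLinearMap.eq_adjoint_iff S T).2 fun w u => ?_).symm
    obtain ⟨a, ha, rfl⟩ := hT1 u
    obtain ⟨b, hb, rfl⟩ := hS1 w
    rw [ha, hb, inner_add_left, inner_add_right, inner_smul_left, inner_smul_right,
      hA.inner_pmap_apply, map_neg, conj_I, neg_neg]
  refine ⟨T, hT1, hT2, ?_, ?_⟩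
  · rw [hST]
    ext w
    obtain ⟨a, ha, hw⟩ := hT1 w
    -- Resolvent identity: apply `S = (A - i)⁻¹` to `w = (A - i) a + 2i a`.
    have h : S w = a + (2 * I) • S a := by
      have h1 : w = (A a + (-I) • (a : H)) + (2 * I) • (a : H) := by
        rw [← hw]; module
      conv_lhs => rw [h1, map_add, map_smul, hS2]
    simp only [sub_apply, smul_apply, mul_apply_eq_comp, ha, h, add_sub_cancel_left]
  · rw [hST]
    ext w
    obtain ⟨b, hb, hw⟩ := hS1 w
    have h : T w = b - (2 * I) • T b := by
      have h1 : w = (A b + I • (b : H)) - (2 * I) • (b : H) := by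
        rw [← hw]; module
      conv_lhs => rw [h1, map_sub, map_smul, hT2]
    simp only [sub_apply, smul_apply, mul_apply_eq_comp, hb, h, sub_sub_cancel]

end Resolvent

/-! ### From the resolvent to a real multiplier -/

section Multiplication

open Complex

/-- The functional calculus is injective, so the operator identity holds pointwise on the spectrum.
-/
theorem conj_sub_self_of_mem_spectrum {H : Type*} [NormedAddCommGroup H]
    [InnerProductSpace ℂ H] [CompleteSpace H] {T : H →L[ℂ] H} (hT : IsStarNormal T) {c : ℂ}
    (h : star T - T = c • (star T * T)) {z : ℂ} (hz : z ∈ spectrum ℂ T) :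
    starRingEnd ℂ z - z = c * (starRingEnd ℂ z * z) := by
  set g : C(spectrum ℂ T, ℂ) := ContinuousMap.restrict (spectrum ℂ T) (ContinuousMap.id ℂ)
  have hg : cfcHom hT g = T := cfcHom_id hT
  have h1 : star g - g = c • (star g * g) := by
    refine cfcHom_injective hT ?_
    rw [map_sub, map_smul, map_mul, map_star, hg, h]
  exact DFunLike.congr_fun h1 ⟨z, hz⟩

/-- Dividing `h` by `|z|²` gives `Im z⁻¹ = 1`, that is, `z⁻¹ = Re z⁻¹ + i`. -/
theorem Complex.re_inv_mul_self {z : ℂ} (hz : z ≠ 0)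
    (h : starRingEnd ℂ z - z = (2 * I) * (starRingEnd ℂ z * z)) :
    ((z⁻¹.re : ℝ) : ℂ) * z = 1 - I * z := by
  have hc : starRingEnd ℂ z ≠ 0 := (map_ne_zero _).2 hz
  have h1 : ((z⁻¹.re : ℝ) : ℂ) = (z⁻¹ + (starRingEnd ℂ z)⁻¹) / 2 := by
    rw [← map_inv₀, add_conj]
    simp
  rw [h1]
  field_simp
  linear_combination -h

/-- An operator which is unitarily equivalent to multiplication by `g` is injective only if `g` is
almost everywhere nonzero. -/
theorem ae_ne_zero_of_injective {H : Type*} [NormedAddCommGroup H]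
    [InnerProductSpace ℂ H] {Y : Type*} [MeasurableSpace Y] {μ : Measure Y}
    [IsFiniteMeasure μ] {T : H → H} (hT : ∀ v, T v = 0 → v = 0) {U : H ≃ₗᵢ[ℂ] Lp ℂ 2 μ} {g : Y → ℂ}
    (hg : Measurable g) (hU : ∀ v, U (T v) =ᵐ[μ] fun y => g y * U v y) : ∀ᵐ y ∂μ, g y ≠ 0 := by
  have hN : MeasurableSet {y | g y = 0} := hg (measurableSet_singleton 0)
  set φ : Lp ℂ 2 μ := indicatorConstLp 2 hN (measure_ne_top μ _) 1
  have hφ : φ =ᵐ[μ] Set.indicator {y | g y = 0} fun _ => 1 := indicatorConstLp_coeFn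
  have h0 : U (T (U.symm φ)) = 0 := by
    refine (Lp.eq_zero_iff_ae_eq_zero).2 ?_
    filter_upwards [hU (U.symm φ), hφ] with y h1 h2
    rw [h1, U.apply_symm_apply, h2]
    by_cases hy : g y = 0 <;> simp [hy]
  have h1 : φ = 0 := by
    have h2 := hT _ (U.map_eq_zero_iff.1 h0)
    rwa [U.symm.map_eq_zero_iff] at h2
  have h2 := (Lp.eq_zero_iff_ae_eq_zero).1 h1
  filter_upwards [hφ, h2] with y h3 h4 hy
  rw [h4] at h3
  simp [hy] at h3

end Multiplication

theorem mainTheorem1 {H : Type*} [NormedAddCommGroup H] [InnerProductSpace ℂ H]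
    [CompleteSpace H] [TopologicalSpace.SeparableSpace H]
    (A : H →ₗ.[ℂ] H) (hA : IsSelfAdjoint A) :
    ∃ (Y : Type) (_ : MeasurableSpace Y) (μ : Measure Y) (_ : IsFiniteMeasure μ)
      (U : H ≃ₗᵢ[ℂ] Lp ℂ 2 μ) (f : Y → ℝ),
      Measurable f ∧
      (∀ v : H, v ∈ A.domain ↔ U v ∈ (mulOperator μ f).domain) ∧
      (∀ (φ : Lp ℂ 2 μ) (hφA : U.symm φ ∈ A.domain) (hφM : φ ∈ (mulOperator μ f).domain),
        U (A ⟨U.symm φ, hφA⟩) = mulOperator μ f ⟨φ, hφM⟩) := by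
  obtain ⟨T, hT1, hT2, hadj, hadj'⟩ := hA.exists_resolvent_I
  -- Cancel `2i` between the two formulas for `star T - T`.
  have hnormal : IsStarNormal T :=
    ⟨smul_right_injective _ (mul_ne_zero two_ne_zero Complex.I_ne_zero) (hadj.symm.trans hadj')⟩
  obtain ⟨μ, hμ, U, hU⟩ := hnormal.exists_unitary
  let g : ℕ × spectrum ℂ T → ℂ := fun y => y.2
  have hgm : Measurable g := measurable_subtype_coe.comp measurable_snd
  let f : ℕ × spectrum ℂ T → ℝ := fun y => (g y)⁻¹.re
  have hT0 : ∀ v, T v = 0 → v = 0 := fun v hv => by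
    obtain ⟨a, ha, rfl⟩ := hT1 v
    have ha0 : a = 0 := Subtype.ext (ha.symm.trans hv)
    simp [ha0]
  have hfg : ∀ᵐ y ∂μ, (f y : ℂ) * g y = 1 - Complex.I * g y := by
    filter_upwards [ae_ne_zero_of_injective hT0 hgm hU] with y hy
    exact Complex.re_inv_mul_self hy (conj_sub_self_of_mem_spectrum hnormal hadj y.2.2)
  have hfA : ∀ v : A.domain, U (A v) =ᵐ[μ] fun y => (f y : ℂ) * U v y := fun v => by
    have h1 := hU (A v + Complex.I • (v : H))
    rw [hT2] at h1
    have h2 : A v = (A v + Complex.I • (v : H)) - Complex.I • (v : H) := by module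
    have h3 : U (A v) = U (A v + Complex.I • (v : H)) - Complex.I • U v := by
      conv_lhs => rw [h2, map_sub, map_smul]
    rw [h3]
    filter_upwards [h1, hfg, Lp.coeFn_sub (U (A v + Complex.I • (v : H))) (Complex.I • U v),
      Lp.coeFn_smul Complex.I (U v)] with y h4 h5 h6 h7
    rw [h6, Pi.sub_apply, h7, Pi.smul_apply, smul_eq_mul, h4, ← mul_assoc (f y : ℂ)]
    change _ = (f y : ℂ) * g y * _
    rw [h5]
    change _ - _ * (g y * _) = _
    ring
  refine ⟨ℕ × spectrum ℂ T, inferInstance, μ, hμ, U, f, ?_, fun v => ⟨fun hv => ?_, fun hv => ?_⟩,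
    fun φ hφA hφM => ?_⟩
  · exact Complex.measurable_re.comp hgm.inv
  · exact (memLp_congr_ae (hfA ⟨v, hv⟩)).1 (Lp.memLp _)
  · have hv' : MemLp (fun y => (f y : ℂ) * U v y) 2 μ := hv
    -- `ψ = (f + i) U v` is what `(A + i) v` must become; since `(f + i) g = 1`, this puts `v` in
    -- the range of `T`, hence in the domain of `A`.
    let ψ : Lp ℂ 2 μ := hv'.toLp + Complex.I • U v
    have h1 : U (T (U.symm ψ)) = U v := by
      refine Lp.ext ?_
      filter_upwards [hU (U.symm ψ), hfg, Lp.coeFn_add hv'.toLp (Complex.I • U v),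
        Lp.coeFn_smul Complex.I (U v), hv'.coeFn_toLp] with y h2 h3 h4 h5 h6
      rw [h2, U.apply_symm_apply, h4, Pi.add_apply, h5, h6, Pi.smul_apply, smul_eq_mul]
      change g y * _ = _
      linear_combination h3 * U v y
    obtain ⟨a, ha, -⟩ := hT1 (U.symm ψ)
    rw [← U.injective h1, ha]
    exact a.2
  · refine Lp.ext ?_
    have hM : mulOperator μ f ⟨φ, hφM⟩ =ᵐ[μ] fun y => (f y : ℂ) * φ y := MemLp.coeFn_toLp hφM
    have h := hfA ⟨U.symm φ, hφA⟩
    rw [U.apply_symm_apply] at h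
    exact h.trans hM.symm
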